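/- Fix $k\ge 1$, let $c_1,\dots,c_k$ be distinct points of $\mathbb{C}$. For complex numbers $r_1,\dots,r_k$ define $$e_i(z)=\prod_{j\ne i}\frac{z-c_j}{c_i-c_j},\qquad v_i=\sum_{j\ne i}\left[-\frac32\,\frac1{(c_i-c_j)^2}+\frac{r_j}{c_i-c_j}\right],$$ and, for an entire function $G$, $$\psi(z)=\sum_{i=1}^k\left[-\frac32\,\frac1{(z-c_i)^2}+\frac{r_i}{z-c_i}+\Bigl(-\frac12 r_i^2-v_i\Bigr)e_i(z)\right]+G(z)\prod_{i=1}^k(z-c_i).\qquad(*)$$ For a non-constant meromorphic function $f$ on $\mathbb{C}$, let $S_f=\frac{f'''}{f'}-\frac32\left(\frac{f''}{f'}\right)^2$ be its Schwarzian derivative, a meromorphic function on $\mathbb{C}$ (defined at the poles of $f$ by taking limits). Critical points are those of $f$ as a holomorphic map to the Riemann sphere, i.e. the points where its local degree is at least $2$ (so multiple poles are critical points); a critical point is simple if the local degree there is $2$. (a) For all $r_1,\dots,r_k\in\mathbb{C}$ and every entire function $G$ there is a function $f$, meromorphic in the entire complex plane, which has precisely $k$ critical points, these being simple and located at $c_1,\dots,c_k$,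 such that $S_f=\psi$ on $\mathbb{C}\setminus\{c_1,\dots,c_k\}$, that is, $S_f=\psi$ as meromorphic functions. (b) Conversely, if $f$ is meromorphic in the entire complex plane and has precisely $k$ critical points, these being simple and located at $c_1,\dots,c_k$, then there are $r_1,\dots,r_k\in\mathbb{C}$ and an entire function $G$ such that $S_f$ is equal to the function $\psi$ in $(*)$. -/

import Mathlib

open Filter Topology

noncomputable section

namespace SchwarzianMerom

/-- A meromorphic function on the whole plane, i.e. a holomorphic map `ℂ → Ĉ` that is not
identically `∞`. It is represented by its unique normal-form function `ℂ → ℂ`: analytic at every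
point that is not a pole, and with the conventional value `0` at the poles. -/
def IsMeromorphicOnPlane (f : ℂ → ℂ) : Prop :=
  MeromorphicNFOn f Set.univ

/-- `f z = ∞`. -/
def IsPole (f : ℂ → ℂ) (z : ℂ) : Prop :=
  meromorphicOrderAt f z < 0

open Classical in
/-- The local degree at `z` of `f`, as a map to the Riemann sphere: the order of vanishing at `z`
of `f - f z` if `f z` is finite, and of `1 / f` (the chart at `∞`) if `f z = ∞`. It is `⊤` if `f`
is constant near `z`. -/
def localDegree (f : ℂ → ℂ) (z : ℂ) : WithTop ℤ :=
  if IsPole f z then meromorphicOrderAt (fun w => (f w)⁻¹) z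
  else meromorphicOrderAt (fun w => f w - f z) z

/-- A critical point of `f`, as a map to the Riemann sphere: the local degree is not `1`.
In particular a pole is a critical point exactly if it is a multiple pole. -/
def IsCriticalPoint (f : ℂ → ℂ) (z : ℂ) : Prop :=
  localDegree f z ≠ 1

/-- A simple critical point: the local degree is `2`. -/
def IsSimpleCriticalPoint (f : ℂ → ℂ) (z : ℂ) : Prop :=
  localDegree f z = 2

/-- The expression `f''' / f' - (3 / 2) (f'' / f') ^ 2`. -/
def schwarzianExpr (f : ℂ → ℂ) (z : ℂ) : ℂ :=
  iteratedDeriv 3 f z / deriv f z - 3 / 2 * (iteratedDeriv 2 f z / deriv f z) ^ 2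

open Classical in
/-- The Schwarzian derivative `S_f`: given by the usual expression where `f` is finite, and by
the limit of that expression at the poles of `f`. It is a meromorphic function with poles
precisely at the critical points of `f`; only its values off the critical points are used. -/
def schwarzian (f : ℂ → ℂ) (z : ℂ) : ℂ :=
  if IsPole f z then limUnder (𝓝[≠] z) (schwarzianExpr f) else schwarzianExpr f z

variable {k : ℕ}

/-- `e_i(z) = ∏_{j ≠ i} (z - c_j) / (c_i - c_j)`. -/
def e (c : Fin k → ℂ) (i : Fin k) (z : ℂ) : ℂ :=
  ∏ j ∈ Finset.univ.erase i, (z - c j) / (c i - c j)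

/-- `v_i = ∑_{j ≠ i} (-(3/2) / (c_i - c_j)² + r_j / (c_i - c_j))`. -/
def v (c r : Fin k → ℂ) (i : Fin k) : ℂ :=
  ∑ j ∈ Finset.univ.erase i, (-(3 / 2) * (1 / (c i - c j) ^ 2) + r j / (c i - c j))

/-- The meromorphic function `ψ` with data `c`, `r`, `G`; its poles are the points `c i`. -/
def psi (c r : Fin k → ℂ) (G : ℂ → ℂ) (z : ℂ) : ℂ :=
  (∑ i, (-(3 / 2) * (1 / (z - c i) ^ 2) + r i / (z - c i)
      + (-(1 / 2) * r i ^ 2 - v c r i) * e c i z))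
    + G z * ∏ i, (z - c i)

/-- `f` is meromorphic in the plane, its critical points are precisely the points `c i`, and they
are simple. -/
def HasSimpleCriticalPointsAt (f : ℂ → ℂ) (c : Fin k → ℂ) : Prop :=
  IsMeromorphicOnPlane f ∧ {z | IsCriticalPoint f z} = Set.range c ∧
    ∀ i, IsSimpleCriticalPoint f (c i)

/-- `S_f = ψ` as meromorphic functions with poles contained in the set of the `c i`: equality at
every other point. -/
def SchwarzianEqPsi (f : ℂ → ℂ) (c r : Fin k → ℂ) (G : ℂ → ℂ) : Prop :=
  ∀ z ∉ Set.range c, schwarzian f z = psi c r G z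

end SchwarzianMerom

end

/-! Both directions rest on one local fact (`hasApparentSingularity_schwarzianOfDeriv`): if `f'` has
a simple zero at `c`, then `S_f` has principal part `-(3/2)/(z-c)² + r/(z-c)` there, and its
constant term is forced to be `-r²/2`. The terms with `v` and `e` give `psi` this expansion at every
`c i`. Two functions with this expansion and the same `r i` differ by a function vanishing at every
`c i`, hence by an entire multiple of `p = ∏ (z - c j)` if the difference is analytic elsewhere
(`exists_entire_sub_eq_mul_prod`). For (b) this multiple is `G`.

For (a), the singular equation `y'' + (ψ/2) y = 0` is replaced by the trace-free system `a' = α a +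
p a₁`, `a₁' = β a - α a₁` with entire coefficients, so there is no monodromy to control. A quotient
`f = a/b` of independent solutions has `f' = K p / b²` with `K` a nonzero constant, so its critical
points are the zeros of `p`, and `S_f` is explicit in `p`, `α`, `β`. Interpolation chooses `α` to
produce the residues `r i`; the remaining difference from `psi` is a multiple of `p`, absorbed by
`β`. -/

/-! ### Linear differential equations with entire coefficients -/

theorem exists_entire_solution {E : Type*} [NormedAddCommGroup E] [NormedSpace ℂ E]
    [CompleteSpace E] {A : ℂ → E →L[ℂ] E} (hA : Differentiable ℂ A) (y₀ : E) :
    ∃ Y : ℂ → E, Y 0 = y₀ ∧ ∀ z, HasDerivAt Y (A z (Y z)) z := by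
  -- Differentiability sits inside the existential so that `choose` yields a total operator, which
  -- can be iterated.
  have step : ∀ f : ℂ → E, ∃ F : ℂ → E, Differentiable ℂ f →
      F 0 = 0 ∧ ∀ z, HasDerivAt F (A z (f z)) z := by
    intro f
    by_cases hf : Differentiable ℂ f
    · have hAf : Differentiable ℂ fun z => A z (f z) := fun z => (hA z).clm_apply (hf z)
      obtain ⟨F, hF0, hF⟩ := hAf.isExactOn_univ.with_val_at 0 0
      exact ⟨F, fun _ => ⟨hF0, fun z => hF z (Set.mem_univ z)⟩⟩
    · exact ⟨0, fun h => absurd h hf⟩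
  choose Φ hΦ using step
  -- These are the Picard increments, not the Picard iterates: the solution is their sum.
  set Y : ℕ → ℂ → E := fun n => Φ^[n] (fun _ => y₀) with hY
  have hYs : ∀ n, Y (n + 1) = Φ (Y n) := fun n => Function.iterate_succ_apply' _ _ _
  have hYd : ∀ n, Differentiable ℂ (Y n) := by
    intro n
    induction n with
    | zero => exact differentiable_const y₀
    | succ n ih => rw [hYs]; exact fun z => ((hΦ _ ih).2 z).differentiableAt
  have hYder : ∀ n z, HasDerivAt (Y (n + 1)) (A z (Y n z)) z := fun n z => by
    rw [hYs]; exact (hΦ _ (hYd n)).2 z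
  have hY0 : ∀ n, Y (n + 1) 0 = 0 := fun n => by rw [hYs]; exact (hΦ _ (hYd n)).1
  have bound : ∀ R : ℝ, ∀ M : ℝ, 0 ≤ M → (∀ z ∈ Metric.ball (0 : ℂ) R, ‖A z‖ ≤ M) →
      ∀ n, ∀ z ∈ Metric.ball (0 : ℂ) R, ‖Y n z‖ ≤ ‖y₀‖ * ((M * ‖z‖) ^ n / n.factorial) := by
    intro R M hM hAM n
    induction n with
    | zero => intro z _; simp [hY]
    | succ n ih =>
      intro z hz
      have hmem : ∀ t ∈ Set.Icc (0 : ℝ) 1, (t : ℂ) * z ∈ Metric.ball (0 : ℂ) R := by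
        intro t ht
        rw [mem_ball_zero_iff] at hz ⊢
        rw [norm_mul, Complex.norm_real, Real.norm_of_nonneg ht.1]
        nlinarith [ht.2, norm_nonneg z]
      have hd : ∀ t : ℝ, HasDerivAt (fun t : ℝ => Y (n + 1) ((t : ℂ) * z))
          (z • A ((t : ℂ) * z) (Y n ((t : ℂ) * z))) t := by
        intro t
        have h1 : HasDerivAt (fun s : ℂ => Y (n + 1) (s * z))
            (z • A ((t : ℂ) * z) (Y n ((t : ℂ) * z))) (t : ℂ) := by
          have := (hYder n ((t : ℂ) * z)).scomp (t : ℂ) ((hasDerivAt_id (t : ℂ)).mul_const z)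
          simpa [Function.comp_def] using this
        simpa [Function.comp_def] using h1.scomp t (Complex.ofRealCLM.hasDerivAt (x := t))
      set C : ℝ := ‖y₀‖ * (M * ‖z‖) ^ (n + 1) / n.factorial
      have hB : ∀ t : ℝ, HasDerivAt (fun t : ℝ => C * (t ^ (n + 1) / (n + 1))) (C * t ^ n) t := by
        intro t
        have hn : (n : ℝ) + 1 ≠ 0 := by positivity
        refine (((hasDerivAt_pow (n + 1) t).div_const ((n : ℝ) + 1)).const_mul C).congr_deriv ?_
        rw [Nat.add_sub_cancel, Nat.cast_add_one, mul_div_cancel_left₀ _ hn]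
      -- Integrates the inductive bound along the segment `t ↦ t z`; the value of `B` at `1` is the
      -- next bound.
      have key := image_norm_le_of_norm_deriv_right_le_deriv_boundary (a := 0) (b := 1)
        (f := fun t : ℝ => Y (n + 1) ((t : ℂ) * z))
        (f' := fun t : ℝ => z • A ((t : ℂ) * z) (Y n ((t : ℂ) * z)))
        (B := fun t : ℝ => C * (t ^ (n + 1) / (n + 1))) (B' := fun t => C * t ^ n)
        (fun t _ => (hd t).continuousAt.continuousWithinAt)
        (fun t _ => (hd t).hasDerivWithinAt) (by simp [hY0]) hB ?_
      · have h1 := key (Set.right_mem_Icc.mpr zero_le_one)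
        simp only [Complex.ofReal_one, one_mul, one_pow] at h1
        refine h1.trans (le_of_eq ?_)
        simp only [C, Nat.factorial_succ]
        push_cast
        field_simp
      · intro t ht
        have ht' := Set.Ico_subset_Icc_self ht
        have hn : ‖(t : ℂ) * z‖ = t * ‖z‖ := by
          rw [norm_mul, Complex.norm_real, Real.norm_of_nonneg ht.1]
        calc ‖z • A ((t : ℂ) * z) (Y n ((t : ℂ) * z))‖
            ≤ ‖z‖ * (M * (‖y₀‖ * ((M * (t * ‖z‖)) ^ n / n.factorial))) := by
              rw [norm_smul]
              refine mul_le_mul_of_nonneg_left ?_ (norm_nonneg z)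
              refine ((A _).le_opNorm _).trans ?_
              refine mul_le_mul (hAM _ (hmem t ht')) ?_ (norm_nonneg _) hM
              rw [← hn]
              exact ih _ (hmem t ht')
          _ = C * t ^ n := by simp only [C]; rw [mul_pow, mul_pow, mul_pow, pow_succ, pow_succ]; ring
  refine ⟨fun z => ∑' n, Y n z, ?_, fun z => ?_⟩
  · show ∑' n, Y n 0 = y₀
    rw [tsum_eq_single 0]
    · rfl
    · intro n hn
      obtain ⟨m, rfl⟩ := Nat.exists_eq_succ_of_ne_zero hn
      exact hY0 m
  · obtain ⟨R, hR⟩ : ∃ R : ℝ, ‖z‖ < R := ⟨‖z‖ + 1, by linarith⟩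
    have hzR : z ∈ Metric.ball (0 : ℂ) R := by simpa using hR
    obtain ⟨M, hM⟩ := (isCompact_closedBall (0 : ℂ) R).exists_bound_of_continuousOn
      hA.continuous.continuousOn
    have hM0 : 0 ≤ M := (norm_nonneg _).trans (hM z (Metric.ball_subset_closedBall hzR))
    have hsum : Summable fun n : ℕ => ‖y₀‖ * ((M * R) ^ n / n.factorial) :=
      (Real.summable_pow_div_factorial (M * R)).mul_left _
    have hle : ∀ n, ∀ w ∈ Metric.ball (0 : ℂ) R, ‖Y n w‖ ≤ ‖y₀‖ * ((M * R) ^ n / n.factorial) := by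
      intro n w hw
      refine (bound R M hM0 (fun w hw => hM w (Metric.ball_subset_closedBall hw)) n w hw).trans ?_
      have : ‖w‖ ≤ R := by simpa using (Metric.ball_subset_closedBall hw)
      gcongr
    have hdiffOn : ∀ n, DifferentiableOn ℂ (Y n) (Metric.ball 0 R) := fun n =>
      (hYd n).differentiableOn
    have hdiff := Complex.differentiableOn_tsum_of_summable_norm hsum hdiffOn Metric.isOpen_ball hle
    have hder := Complex.hasSum_deriv_of_summable_norm hsum hdiffOn Metric.isOpen_ball hle hzR
    have hs : Summable fun n => Y n z :=
      Summable.of_norm_bounded hsum fun n => hle n z hzR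
    have hs' : HasSum (fun n => deriv (Y n) z) (A z (∑' n, Y n z)) := by
      rw [← hasSum_nat_add_iff' 1]
      have h0 : deriv (Y 0) z = 0 := deriv_const z y₀
      simpa [h0, (hYder _ z).deriv] using (A z).hasSum hs.hasSum
    rw [← hder.unique hs']
    exact (hdiff.differentiableAt (Metric.isOpen_ball.mem_nhds hzR)).hasDerivAt

/-! ### The Schwarzian near a simple zero of the derivative -/

noncomputable section

namespace SchwarzianMerom

/-- The expression `p'' / p - (3 / 2) (p' / p) ^ 2`, which is the Schwarzian derivative of any
primitive of `p`. -/
def schwarzianOfDeriv (p : ℂ → ℂ) (z : ℂ) : ℂ :=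
  deriv (deriv p) z / p z - 3 / 2 * (deriv p z / p z) ^ 2

theorem schwarzianExpr_eq (f : ℂ → ℂ) : schwarzianExpr f = schwarzianOfDeriv (deriv f) := by
  funext z
  simp [schwarzianExpr, schwarzianOfDeriv, iteratedDeriv_succ]

theorem schwarzianOfDeriv_congr {p q : ℂ → ℂ} {z : ℂ} (h : p =ᶠ[𝓝 z] q) :
    schwarzianOfDeriv p z = schwarzianOfDeriv q z := by
  simp only [schwarzianOfDeriv, h.deriv.deriv_eq, h.deriv_eq, h.eq_of_nhds]

/-- With `l = p'/p` one has `p''/p = l' + l²`. All later Schwarzian computations go through `l`. -/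
theorem schwarzianOfDeriv_eq_of_logDeriv {p l : ℂ → ℂ} {l' z : ℂ}
    (hp : ∀ᶠ w in 𝓝 z, HasDerivAt p (p w * l w) w) (hl : HasDerivAt l l' z) (hz : p z ≠ 0) :
    schwarzianOfDeriv p z = l' - l z ^ 2 / 2 := by
  have h1 : deriv p =ᶠ[𝓝 z] fun w => p w * l w := hp.mono fun w hw => hw.deriv
  have h2 : deriv (deriv p) z = p z * l z * l z + p z * l' := by
    rw [h1.deriv_eq]
    exact (hp.self_of_nhds.mul hl).deriv
  rw [schwarzianOfDeriv, h2, hp.self_of_nhds.deriv]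
  field_simp
  ring

theorem schwarzianOfDeriv_analyticAt {p : ℂ → ℂ} {z : ℂ} (hp : AnalyticAt ℂ p z) (hz : p z ≠ 0) :
    AnalyticAt ℂ (schwarzianOfDeriv p) z := by
  unfold schwarzianOfDeriv
  exact (hp.deriv.deriv.div hp hz).sub (analyticAt_const.mul ((hp.deriv.div hp hz).pow 2))

/-- The case of Möbius invariance needed to pass to the chart at `∞`. Where `f' = 0`, both sides are
`0` by the convention for division. -/
theorem schwarzianExpr_inv {f : ℂ → ℂ} {z : ℂ} (hf : AnalyticAt ℂ f z) (hz : f z ≠ 0) :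
    schwarzianExpr (fun w => (f w)⁻¹) z = schwarzianExpr f z := by
  have hne : ∀ᶠ w in 𝓝 z, f w ≠ 0 := hf.continuousAt.eventually_ne hz
  have hd : deriv (fun w => (f w)⁻¹) =ᶠ[𝓝 z] fun w => -deriv f w / f w ^ 2 := by
    filter_upwards [hne, hf.eventually_analyticAt] with w hw hfw
    exact (hfw.differentiableAt.hasDerivAt.inv hw).deriv
  rw [schwarzianExpr_eq, schwarzianExpr_eq, schwarzianOfDeriv_congr hd]
  by_cases h0 : deriv f z = 0
  · simp [schwarzianOfDeriv, h0]
  have hp : AnalyticAt ℂ (deriv f) z := hf.deriv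
  have hl : AnalyticAt ℂ (fun w => deriv (deriv f) w / deriv f w) z := hp.deriv.div hp h0
  have hne' : ∀ᶠ w in 𝓝 z, deriv f w ≠ 0 := hp.continuousAt.eventually_ne h0
  rw [schwarzianOfDeriv_eq_of_logDeriv (p := deriv f)
    (l := fun w => deriv (deriv f) w / deriv f w) ?_ hl.differentiableAt.hasDerivAt h0]
  · rw [schwarzianOfDeriv_eq_of_logDeriv
      (l := fun w => deriv (deriv f) w / deriv f w - 2 * (deriv f w / f w))
      ?_ (hl.differentiableAt.hasDerivAt.sub
        ((hp.differentiableAt.hasDerivAt.div hf.differentiableAt.hasDerivAt hz).const_mul 2)) ?_]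
    · field_simp
      ring
    · filter_upwards [hne, hne', hf.eventually_analyticAt] with w hw hw' hfw
      refine (hfw.deriv.differentiableAt.hasDerivAt.fun_neg.fun_div
        (hfw.differentiableAt.hasDerivAt.fun_pow 2) (pow_ne_zero 2 hw)).congr_deriv ?_
      simp only [Nat.cast_ofNat, Nat.add_one_sub_one, pow_one]
      field_simp
      ring
    · simp [h0, hz]
  · filter_upwards [hne', hf.eventually_analyticAt] with w hw' hfw
    refine hfw.deriv.differentiableAt.hasDerivAt.congr_deriv ?_
    rw [mul_div_cancel₀ _ hw']

/-- `F` has at `c` the principal part `-(3/2) / (z - c)² + r / (z - c)` and the constant term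
`-r² / 2`. -/
def HasApparentSingularity (F : ℂ → ℂ) (c r : ℂ) : Prop :=
  ∃ A : ℂ → ℂ, AnalyticAt ℂ A c ∧ A c = -(1 / 2) * r ^ 2 ∧
    F =ᶠ[𝓝[≠] c] fun z => -(3 / 2) * (1 / (z - c) ^ 2) + r / (z - c) + A z

theorem HasApparentSingularity.congr {F H : ℂ → ℂ} {c r : ℂ} (h : HasApparentSingularity F c r)
    (hFH : F =ᶠ[𝓝[≠] c] H) : HasApparentSingularity H c r := by
  obtain ⟨A, hA, hAc, hF⟩ := h
  exact ⟨A, hA, hAc, hFH.symm.trans hF⟩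

theorem analyticAt_dslope {f : ℂ → ℂ} {c : ℂ} (hf : AnalyticAt ℂ f c) :
    AnalyticAt ℂ (dslope f c) c := by
  obtain ⟨p, hp⟩ := hf
  exact hp.has_fpower_series_dslope_fslope.analyticAt

theorem eq_add_mul_dslope (f : ℂ → ℂ) (c z : ℂ) : f z = f c + (z - c) * dslope f c z := by
  have := sub_smul_dslope f c z
  rw [smul_eq_mul] at this
  rw [this]
  ring

theorem schwarzianOfDeriv_sub_mul {p u : ℂ → ℂ} {c z : ℂ} (hz : z ≠ c)
    (hu : AnalyticAt ℂ u z) (huz : u z ≠ 0) (hp : ∀ᶠ w in 𝓝 z, p w = (w - c) * u w) :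
    deriv p z / p z = 1 / (z - c) + deriv u z / u z ∧
    schwarzianOfDeriv p z = -1 / (z - c) ^ 2 + deriv (fun w => deriv u w / u w) z
      - (1 / (z - c) + deriv u z / u z) ^ 2 / 2 := by
  have hx : z - c ≠ 0 := sub_ne_zero.mpr hz
  have hder : ∀ w, AnalyticAt ℂ u w →
      HasDerivAt (fun w => (w - c) * u w) (u w + (w - c) * deriv u w) w := by
    intro w hw
    simpa using ((hasDerivAt_id w).sub_const c).fun_mul hw.differentiableAt.hasDerivAt
  have hl : HasDerivAt (fun w => 1 / (w - c) + deriv u w / u w)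
      (-1 / (z - c) ^ 2 + deriv (fun w => deriv u w / u w) z) z := by
    have h1 := (hasDerivAt_const z (1 : ℂ)).fun_div ((hasDerivAt_id z).sub_const c) hx
    have h2 : AnalyticAt ℂ (fun w => deriv u w / u w) z := hu.deriv.div hu huz
    refine (h1.fun_add h2.differentiableAt.hasDerivAt).congr_deriv ?_
    simp
  constructor
  · have hp' : p =ᶠ[𝓝 z] fun w => (w - c) * u w := hp
    rw [hp'.deriv_eq, (hder z hu).deriv, hp'.eq_of_nhds]
    field_simp
  · have hp' : p =ᶠ[𝓝 z] fun w => (w - c) * u w := hp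
    rw [schwarzianOfDeriv_congr hp']
    refine schwarzianOfDeriv_eq_of_logDeriv (p := fun w => (w - c) * u w)
      (l := fun w => 1 / (w - c) + deriv u w / u w) ?_ hl (mul_ne_zero hx huz)
    filter_upwards [hu.eventually_analyticAt, hu.continuousAt.eventually_ne huz,
      eventually_ne_nhds hz] with w hw hw0 hwc
    refine (hder w hw).congr_deriv ?_
    have : w - c ≠ 0 := sub_ne_zero.mpr hwc
    field_simp

/-- Put `m = p'/p - 2α = 1/(z-c) + h`. The expression equals `m' - m²/2 = -(3/2)/(z-c)² - h/(z-c) +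
h' - h²/2`. In the constant term, `h'(c)` cancels against the linear term of `h`, leaving `-h(c)²/2`
with `r = -h(c)`. Part (b) uses `α = 0`, part (a) a general `α`. -/
theorem hasApparentSingularity_schwarzianOfDeriv {p u α : ℂ → ℂ} {c : ℂ}
    (hu : AnalyticAt ℂ u c) (huc : u c ≠ 0) (hα : AnalyticAt ℂ α c)
    (hp : ∀ᶠ z in 𝓝 c, p z = (z - c) * u z) :
    HasApparentSingularity (fun z => schwarzianOfDeriv p z + 2 * α z * (deriv p z / p z)
      - 2 * deriv α z - 2 * α z ^ 2) c (2 * α c - deriv u c / u c) := by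
  set h : ℂ → ℂ := fun z => deriv u z / u z - 2 * α z with hh
  have hu' : AnalyticAt ℂ (fun z => deriv u z / u z) c := hu.deriv.div hu huc
  have hha : AnalyticAt ℂ h c := hu'.sub (analyticAt_const.mul hα)
  have hk := analyticAt_dslope hha
  generalize hkdef : dslope h c = k at hk
  have hfac : ∀ z, h z = h c + (z - c) * k z := fun z => by
    rw [← hkdef]
    exact eq_add_mul_dslope h c z
  have hhc : 2 * α c - deriv u c / u c = - h c := by simp [hh]
  rw [hhc]
  refine ⟨fun z => (z - c) * (deriv k z - h c * k z - (z - c) * k z ^ 2 / 2)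
    - (1 / 2) * (-h c) ^ 2, ?_, by simp, ?_⟩
  · have := hk.deriv
    fun_prop
  · have hne : ∀ᶠ z in 𝓝[≠] c, z ≠ c := eventually_mem_nhdsWithin
    have ev : ∀ᶠ z in 𝓝 c, (∀ᶠ w in 𝓝 z, p w = (w - c) * u w) ∧ AnalyticAt ℂ u z ∧ u z ≠ 0 ∧
        AnalyticAt ℂ α z ∧ AnalyticAt ℂ k z :=
      hp.eventually_nhds.and (hu.eventually_analyticAt.and
        ((hu.continuousAt.eventually_ne huc).and (hα.eventually_analyticAt.and
          hk.eventually_analyticAt)))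
    filter_upwards [hne, eventually_nhdsWithin_of_eventually_nhds ev]
      with z hz ⟨hpz, huz, huz0, hαz, hkz⟩
    have hx : z - c ≠ 0 := sub_ne_zero.mpr hz
    obtain ⟨hpd, hS⟩ := schwarzianOfDeriv_sub_mul hz huz huz0 hpz
    have hdh : deriv (fun w => deriv u w / u w) z
        = 2 * deriv α z + (k z + (z - c) * deriv k z) := by
      have h2 : AnalyticAt ℂ (fun w => deriv u w / u w) z := huz.deriv.div huz huz0
      have e1 : deriv h z = deriv (fun w => deriv u w / u w) z - 2 * deriv α z :=
        (h2.differentiableAt.hasDerivAt.sub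
          (hαz.differentiableAt.hasDerivAt.const_mul 2)).deriv
      have e2 : HasDerivAt h (k z + (z - c) * deriv k z) z := by
        rw [show h = fun w => h c + (w - c) * k w from funext hfac]
        refine ((((hasDerivAt_id z).sub_const c).fun_mul
          hkz.differentiableAt.hasDerivAt).const_add (h c)).congr_deriv ?_
        simp
      rw [← e2.deriv, e1]
      ring
    have hhz : deriv u z / u z = 2 * α z + (h c + (z - c) * k z) := by
      rw [← hfac z, hh]
      ring
    rw [hS, hpd, hhz, hdh]
    generalize h c = a, z - c = x at *
    field_simp
    ring

/-! ### Removing singularities and dividing by `∏ (z - c j)` -/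

/-- Removable singularities, all at once. -/
theorem exists_differentiable_of_eventuallyEq {Q : ℂ → ℂ}
    (hQ : ∀ z, ∃ g, AnalyticAt ℂ g z ∧ Q =ᶠ[𝓝[≠] z] g) :
    ∃ G : ℂ → ℂ, Differentiable ℂ G ∧ ∀ z, ContinuousAt Q z → G z = Q z := by
  have lim : ∀ {z : ℂ} {g : ℂ → ℂ}, ContinuousAt g z → Q =ᶠ[𝓝[≠] z] g →
      limUnder (𝓝[≠] z) Q = g z := fun hg h =>
    ((hg.tendsto.mono_left nhdsWithin_le_nhds).congr' h.symm).limUnder_eq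
  refine ⟨fun z => limUnder (𝓝[≠] z) Q, fun z => ?_, fun z hz => lim hz .rfl⟩
  obtain ⟨g, hg, hQg⟩ := hQ z
  have : (fun w => limUnder (𝓝[≠] w) Q) =ᶠ[𝓝 z] g := by
    have h1 : ∀ᶠ w in 𝓝 z, w ≠ z → ∀ᶠ y in 𝓝[≠] w, Q y = g y := by
      filter_upwards [(eventually_nhdsWithin_iff.mp hQg).eventually_nhds] with w hw hwz
      refine eventually_nhdsWithin_of_eventually_nhds ?_
      filter_upwards [hw, eventually_ne_nhds hwz] with y hy hyz using hy hyz
    filter_upwards [h1, hg.eventually_analyticAt] with w hw hgw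
    by_cases hwz : w = z
    · subst hwz; exact lim hgw.continuousAt hQg
    · exact lim hgw.continuousAt (hw hwz)
  exact (hg.differentiableAt.congr_of_eventuallyEq this)

variable {k : ℕ}

theorem prod_sub_eq (c : Fin k → ℂ) (i : Fin k) (z : ℂ) :
    ∏ j, (z - c j) = (z - c i) * ∏ j ∈ Finset.univ.erase i, (z - c j) :=
  (Finset.mul_prod_erase _ _ (Finset.mem_univ i)).symm

theorem prod_erase_ne_zero {c : Fin k → ℂ} (hc : Function.Injective c) (i : Fin k) :
    ∏ j ∈ Finset.univ.erase i, (c i - c j) ≠ 0 :=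
  Finset.prod_ne_zero_iff.mpr fun _ hj =>
    sub_ne_zero.mpr (hc.ne (Finset.ne_of_mem_erase hj).symm)

theorem prod_sub_ne_zero {c : Fin k → ℂ} {z : ℂ} (hz : z ∉ Set.range c) :
    ∏ j, (z - c j) ≠ 0 :=
  Finset.prod_ne_zero_iff.mpr fun j _ => sub_ne_zero.mpr fun h => hz ⟨j, h.symm⟩

theorem differentiable_prod_sub (c : Fin k → ℂ) (s : Finset (Fin k)) :
    Differentiable ℂ fun z => ∏ j ∈ s, (z - c j) := by
  fun_prop

/-- At `c i` the principal parts cancel and the constant terms, both `-(r i)²/2`, agree, so the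
difference has a zero there and its quotient by the product extends analytically. -/
theorem exists_entire_sub_eq_mul_prod {c r : Fin k → ℂ} (hc : Function.Injective c)
    {F H : ℂ → ℂ} (hF : ∀ i, HasApparentSingularity F (c i) (r i))
    (hH : ∀ i, HasApparentSingularity H (c i) (r i))
    (hFH : ∀ z ∉ Set.range c, AnalyticAt ℂ (fun z => F z - H z) z) :
    ∃ G : ℂ → ℂ, Differentiable ℂ G ∧
      ∀ z ∉ Set.range c, F z - H z = G z * ∏ j, (z - c j) := by
  have hPa : ∀ z, AnalyticAt ℂ (fun z => ∏ j, (z - c j)) z := fun z =>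
    (differentiable_prod_sub c _).analyticAt z
  have hQa : ∀ z ∉ Set.range c, AnalyticAt ℂ (fun z => (F z - H z) / ∏ j, (z - c j)) z :=
    fun z hz => (hFH z hz).div (hPa z) (prod_sub_ne_zero hz)
  obtain ⟨G, hG, hGQ⟩ := exists_differentiable_of_eventuallyEq
    (Q := fun z => (F z - H z) / ∏ j, (z - c j)) fun z => by
      by_cases hz : z ∈ Set.range c
      · obtain ⟨i, rfl⟩ := hz
        obtain ⟨A, hA, hAc, hFA⟩ := hF i
        obtain ⟨B, hB, hBc, hHB⟩ := hH i
        have hd : AnalyticAt ℂ (fun z => A z - B z) (c i) := hA.sub hB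
        refine ⟨fun z => dslope (fun z => A z - B z) (c i) z /
          ∏ j ∈ Finset.univ.erase i, (z - c j), (analyticAt_dslope hd).div
            ((differentiable_prod_sub c _).analyticAt _) (prod_erase_ne_zero hc i), ?_⟩
        filter_upwards [hFA, hHB, eventually_mem_nhdsWithin] with z h1 h2 h3
        have h4 := eq_add_mul_dslope (fun z => A z - B z) (c i) z
        simp only [hAc, hBc, sub_self, zero_add] at h4
        have hx : z - c i ≠ 0 := sub_ne_zero.mpr h3
        rw [h1, h2, prod_sub_eq c i, add_sub_add_left_eq_sub, h4, mul_div_mul_left _ _ hx]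
      · exact ⟨_, hQa z hz, .rfl⟩
  refine ⟨G, hG, fun z hz => ?_⟩
  rw [hGQ z (hQa z hz).continuousAt, div_mul_cancel₀ _ (prod_sub_ne_zero hz)]

/-! ### The local form of `psi` -/

theorem e_self (c : Fin k → ℂ) (hc : Function.Injective c) (i : Fin k) : e c i (c i) = 1 :=
  Finset.prod_eq_one fun _ hj =>
    div_self (sub_ne_zero.mpr (hc.ne (Finset.ne_of_mem_erase hj).symm))

theorem e_of_ne (c : Fin k → ℂ) {i j : Fin k} (hij : j ≠ i) : e c i (c j) = 0 :=
  Finset.prod_eq_zero (Finset.mem_erase.mpr ⟨hij, Finset.mem_univ j⟩) (by simp)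

theorem differentiable_e (c : Fin k → ℂ) (i : Fin k) : Differentiable ℂ (e c i) := by
  unfold e
  fun_prop

theorem analyticAt_psi {c r : Fin k → ℂ} {G : ℂ → ℂ} (hG : Differentiable ℂ G) {z : ℂ}
    (hz : z ∉ Set.range c) : AnalyticAt ℂ (psi c r G) z := by
  have h : ∀ i, z - c i ≠ 0 := fun i => sub_ne_zero.mpr fun h => hz ⟨i, h.symm⟩
  have hG' := hG.analyticAt z
  have he : ∀ i, AnalyticAt ℂ (e c i) z := fun i => (differentiable_e c i).analyticAt z
  have hP := (differentiable_prod_sub c Finset.univ).analyticAt z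
  refine AnalyticAt.add (Finset.analyticAt_fun_sum _ fun i _ => ?_) (hG'.mul hP)
  refine ((analyticAt_const.mul (analyticAt_const.fun_div ((analyticAt_id.fun_sub analyticAt_const).fun_pow 2)
      (pow_ne_zero 2 (h i)))).add
    (analyticAt_const.div (by fun_prop) (h i))).add (analyticAt_const.mul (he i))

/-- The polar terms of the other points sum to `v c r i` at `c i`; the coefficient of `e c i`
removes this and installs `-(r i)²/2`. -/
theorem hasApparentSingularity_psi {c r : Fin k → ℂ} (hc : Function.Injective c) {G : ℂ → ℂ}
    (hG : Differentiable ℂ G) (i : Fin k) : HasApparentSingularity (psi c r G) (c i) (r i) := by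
  have hG' := hG.analyticAt (c i)
  have he : ∀ j, AnalyticAt ℂ (e c j) (c i) := fun j => (differentiable_e c j).analyticAt _
  have hP := (differentiable_prod_sub c Finset.univ).analyticAt (c i)
  refine ⟨fun z => (-(1 / 2) * r i ^ 2 - v c r i) * e c i z
    + (∑ j ∈ Finset.univ.erase i, (-(3 / 2) * (1 / (z - c j) ^ 2) + r j / (z - c j)
      + (-(1 / 2) * r j ^ 2 - v c r j) * e c j z)) + G z * ∏ j, (z - c j), ?_, ?_, ?_⟩
  · refine ((analyticAt_const.mul (he i)).add
      (Finset.analyticAt_fun_sum _ fun j hj => ?_)).add (hG'.mul hP)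
    have h : c i - c j ≠ 0 := sub_ne_zero.mpr (hc.ne (Finset.ne_of_mem_erase hj).symm)
    exact ((analyticAt_const.mul (analyticAt_const.fun_div ((analyticAt_id.fun_sub analyticAt_const).fun_pow 2)
      (pow_ne_zero 2 h))).add
      (analyticAt_const.div (by fun_prop) h)).add (analyticAt_const.mul (he j))
  · have h1 : (∑ j ∈ Finset.univ.erase i, (-(3 / 2) * (1 / (c i - c j) ^ 2) + r j / (c i - c j)
        + (-(1 / 2) * r j ^ 2 - v c r j) * e c j (c i))) = v c r i :=
      Finset.sum_congr rfl fun j hj => by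
        rw [e_of_ne c (Finset.ne_of_mem_erase hj).symm, mul_zero, add_zero]
    simp only [h1, e_self c hc, prod_sub_eq c i, sub_self]
    ring
  · refine Eventually.of_forall fun z => ?_
    simp only [psi]
    rw [← Finset.add_sum_erase _ _ (Finset.mem_univ i)]
    ring

/-! ### Local degree, charts on the sphere, and part (b) -/

theorem map_natCast_add_one_eq_one {n : ℕ∞} :
    (n + 1).map (Nat.cast : ℕ → ℤ) = (1 : WithTop ℤ) ↔ n = 0 := by
  induction n using ENat.recTopCoe with
  | top => simp
  | coe n =>
    rw [← Nat.cast_one, ← Nat.cast_add, ENat.map_natCast]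
    norm_cast
    omega

theorem map_natCast_add_one_eq_two {n : ℕ∞} :
    (n + 1).map (Nat.cast : ℕ → ℤ) = (2 : WithTop ℤ) ↔ n = 1 := by
  induction n using ENat.recTopCoe with
  | top => simp
  | coe n =>
    rw [← Nat.cast_one, ← Nat.cast_add, ENat.map_natCast]
    rw [show (2 : WithTop ℤ) = ((2 : ℤ) : WithTop ℤ) from rfl, WithTop.coe_inj]
    norm_cast
    omega

theorem meromorphicOrderAt_sub_eq {g : ℂ → ℂ} {z : ℂ} (hg : AnalyticAt ℂ g z) :
    meromorphicOrderAt (fun w => g w - g z) z =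
      (analyticOrderAt (deriv g) z + 1).map (Nat.cast : ℕ → ℤ) := by
  rw [hg.analyticOrderAt_deriv_add_one]
  exact (hg.sub analyticAt_const).meromorphicOrderAt_eq

theorem not_isPole_of_analyticAt {f : ℂ → ℂ} {z : ℂ} (hf : AnalyticAt ℂ f z) : ¬ IsPole f z :=
  not_lt.mpr hf.meromorphicOrderAt_nonneg

theorem localDegree_of_analyticAt {f : ℂ → ℂ} {z : ℂ} (hf : AnalyticAt ℂ f z) :
    localDegree f z = (analyticOrderAt (deriv f) z + 1).map (Nat.cast : ℕ → ℤ) := by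
  rw [localDegree, if_neg (not_isPole_of_analyticAt hf), meromorphicOrderAt_sub_eq hf]

theorem localDegree_of_isPole {f g : ℂ → ℂ} {z : ℂ} (h : IsPole f z)
    (hg : AnalyticAt ℂ g z) (hgz : g z = 0) (hfg : ∀ w, (f w)⁻¹ = g w) :
    localDegree f z = (analyticOrderAt (deriv g) z + 1).map (Nat.cast : ℕ → ℤ) := by
  rw [localDegree, if_pos h, funext hfg, ← meromorphicOrderAt_sub_eq hg]
  simp [hgz]

theorem schwarzian_eventuallyEq {f : ℂ → ℂ} {z : ℂ} (hf : MeromorphicAt f z) :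
    schwarzian f =ᶠ[𝓝[≠] z] schwarzianExpr f := by
  filter_upwards [hf.eventually_analyticAt] with w hw
  exact if_neg (not_isPole_of_analyticAt hw)

/-- Near every point, `f` or `1 / f` is a holomorphic chart expression of `f`. -/
theorem exists_chart {f : ℂ → ℂ} {z : ℂ} (hf : MeromorphicNFAt f z) :
    ∃ g : ℂ → ℂ, AnalyticAt ℂ g z ∧
      localDegree f z = (analyticOrderAt (deriv g) z + 1).map (Nat.cast : ℕ → ℤ) ∧
      schwarzianExpr f =ᶠ[𝓝[≠] z] schwarzianExpr g ∧ (¬ IsPole f z → f = g) := by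
  by_cases h : IsPole f z
  · have h0 : f z = 0 := by
      rcases meromorphicNFAt_iff_analyticAt_or.mp hf with h1 | h1
      · exact absurd h (not_isPole_of_analyticAt h1)
      · exact h1.2.2
    have hinv : 0 < meromorphicOrderAt f⁻¹ z := by
      rw [meromorphicOrderAt_inv]
      unfold IsPole at h
      cases ho : meromorphicOrderAt f z with
      | top => simp [ho] at h
      | coe n =>
        rw [ho] at h
        norm_cast at h ⊢
        omega
    have ha : AnalyticAt ℂ f⁻¹ z :=
      hf.inv.meromorphicOrderAt_nonneg_iff_analyticAt.mp hinv.le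
    refine ⟨f⁻¹, ha, localDegree_of_isPole h ha (by simp [h0]) fun w => rfl, ?_,
      fun h' => absurd h h'⟩
    have hne := (meromorphicOrderAt_ne_top_iff_eventually_ne_zero hf.meromorphicAt).mp
      (ne_top_of_lt h)
    filter_upwards [hf.meromorphicAt.eventually_analyticAt, hne] with w hw hw0
    exact (schwarzianExpr_inv hw hw0).symm
  · have ha := hf.meromorphicOrderAt_nonneg_iff_analyticAt.mp (not_lt.mp h)
    exact ⟨f, ha, localDegree_of_analyticAt ha, .rfl, fun _ => rfl⟩

theorem exists_hasApparentSingularity_schwarzian {f : ℂ → ℂ} {c : ℂ} (hf : MeromorphicNFAt f c)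
    (hc : IsSimpleCriticalPoint f c) : ∃ r, HasApparentSingularity (schwarzian f) c r := by
  obtain ⟨g, hg, hdeg, hS, -⟩ := exists_chart hf
  have h1 : analyticOrderAt (deriv g) c = 1 := map_natCast_add_one_eq_two.mp (hdeg ▸ hc)
  obtain ⟨u, hu, huc, hgu⟩ := (hg.deriv.analyticOrderAt_eq_natCast (n := 1)).mp (by simpa using h1)
  refine ⟨_, (hasApparentSingularity_schwarzianOfDeriv hu huc (analyticAt_const (v := 0))
    (p := deriv g) (by simpa using hgu)).congr ?_⟩
  refine EventuallyEq.trans ?_ ((schwarzian_eventuallyEq hf.meromorphicAt).trans hS).symm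
  simp [schwarzianExpr_eq]

/-- In a chart `g` one has `g' z ≠ 0`, also at a simple pole; there the limit in `schwarzian`
supplies the right value. -/
theorem analyticAt_schwarzian {f : ℂ → ℂ} {z : ℂ} (hf : MeromorphicNFAt f z)
    (hz : ¬ IsCriticalPoint f z) : AnalyticAt ℂ (schwarzian f) z := by
  obtain ⟨g, hg, hdeg, hS, hfg⟩ := exists_chart hf
  have h1 : analyticOrderAt (deriv g) z = 0 :=
    map_natCast_add_one_eq_one.mp (hdeg ▸ not_not.mp hz)
  have ha : AnalyticAt ℂ (schwarzianExpr g) z := by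
    rw [schwarzianExpr_eq]
    exact schwarzianOfDeriv_analyticAt hg.deriv (hg.deriv.analyticOrderAt_eq_zero.mp h1)
  have hval : schwarzian f z = schwarzianExpr g z := by
    by_cases h : IsPole f z
    · rw [schwarzian, if_pos h]
      exact ((ha.continuousAt.tendsto.mono_left nhdsWithin_le_nhds).congr' hS.symm).limUnder_eq
    · rw [schwarzian, if_neg h, hfg h]
  refine ha.congr ?_
  have := ((schwarzian_eventuallyEq hf.meromorphicAt).trans hS).symm
  filter_upwards [eventually_nhdsWithin_iff.mp this] with w hw
  by_cases hwz : w = z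
  · rw [hwz, hval]
  · exact hw hwz

theorem psi_eq_add (c r : Fin k → ℂ) (G : ℂ → ℂ) (z : ℂ) :
    psi c r G z = psi c r 0 z + G z * ∏ i, (z - c i) := by
  simp [psi]

theorem exists_schwarzianEqPsi {f : ℂ → ℂ} {c : Fin k → ℂ} (hc : Function.Injective c)
    (hf : HasSimpleCriticalPointsAt f c) :
    ∃ (r : Fin k → ℂ) (G : ℂ → ℂ), Differentiable ℂ G ∧ SchwarzianEqPsi f c r G := by
  obtain ⟨hm, hcrit, hsimple⟩ := hf
  choose r hr using fun i =>
    exists_hasApparentSingularity_schwarzian (hm (Set.mem_univ (c i))) (hsimple i)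
  have h0 : Differentiable ℂ (0 : ℂ → ℂ) := differentiable_const 0
  obtain ⟨G, hG, hGF⟩ := exists_entire_sub_eq_mul_prod hc hr
    (fun i => hasApparentSingularity_psi hc h0 i) fun z hz =>
      (analyticAt_schwarzian (hm (Set.mem_univ z)) (by rw [← hcrit] at hz; exact hz)).sub
        (analyticAt_psi h0 hz)
  refine ⟨r, G, hG, fun z hz => ?_⟩
  rw [psi_eq_add, ← hGF z hz]
  ring

/-! ### The regular linear system and quotients of its solutions -/

/-- `(a, a₁)` solves the linear system `a' = α a + p a₁`, `a₁' = β a - α a₁`. -/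
def SolvesSystem (p α β a a₁ : ℂ → ℂ) : Prop :=
  ∀ z, HasDerivAt a (α z * a z + p z * a₁ z) z ∧ HasDerivAt a₁ (β z * a z - α z * a₁ z) z

/-- The coefficient matrix has trace zero. -/
theorem SolvesSystem.wronskian_eq {p α β a a₁ b b₁ : ℂ → ℂ} (ha : SolvesSystem p α β a a₁)
    (hb : SolvesSystem p α β b b₁) (z : ℂ) :
    a₁ z * b z - a z * b₁ z = a₁ 0 * b 0 - a 0 * b₁ 0 := by
  have h : ∀ w, HasDerivAt (fun w => a₁ w * b w - a w * b₁ w) 0 w := fun w =>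
    (((ha w).2.fun_mul (hb w).1).fun_sub ((ha w).1.fun_mul (hb w).2)).congr_deriv (by ring)
  exact is_const_of_deriv_eq_zero (fun w => (h w).differentiableAt) (fun w => (h w).deriv) z 0

theorem SolvesSystem.analyticAt {p α β a a₁ : ℂ → ℂ} (ha : SolvesSystem p α β a a₁) (z : ℂ) :
    AnalyticAt ℂ a z :=
  Differentiable.analyticAt (fun w => (ha w).1.differentiableAt) z

section quotient

variable {p α β a a₁ b b₁ : ℂ → ℂ} {K z : ℂ}

theorem SolvesSystem.deriv_div_eventuallyEq (ha : SolvesSystem p α β a a₁)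
    (hb : SolvesSystem p α β b b₁) (hK : ∀ z, a₁ z * b z - a z * b₁ z = K) (hz : b z ≠ 0) :
    deriv (fun w => a w / b w) =ᶠ[𝓝 z] fun w => p w * (K / b w ^ 2) := by
  filter_upwards [(hb.analyticAt z).continuousAt.eventually_ne hz] with w hw
  rw [((ha w).1.fun_div (hb w).1 hw).deriv, ← hK w]
  ring

theorem SolvesSystem.analyticOrderAt_deriv_div (ha : SolvesSystem p α β a a₁)
    (hb : SolvesSystem p α β b b₁) (hK : ∀ z, a₁ z * b z - a z * b₁ z = K) (hK0 : K ≠ 0)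
    (hp : AnalyticAt ℂ p z) (hz : b z ≠ 0) :
    analyticOrderAt (deriv fun w => a w / b w) z = analyticOrderAt p z := by
  have hq : AnalyticAt ℂ (fun w => K / b w ^ 2) z :=
    analyticAt_const.div ((hb.analyticAt z).pow 2) (pow_ne_zero 2 hz)
  rw [analyticOrderAt_congr (ha.deriv_div_eventuallyEq hb hK hz)]
  refine (analyticOrderAt_mul hp hq).trans ?_
  rw [hq.analyticOrderAt_eq_zero.mpr (by simp [hK0, hz]), add_zero]

/-- The logarithmic derivative of `K p / b²` is `p'/p - 2(α + p w)` with `w = b₁/b`. Since `w' = β -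
2αw - p w²`, every term containing `w` cancels, so the result does not depend on the chosen
solutions. -/
theorem SolvesSystem.schwarzianExpr_div (ha : SolvesSystem p α β a a₁)
    (hb : SolvesSystem p α β b b₁) (hK : ∀ z, a₁ z * b z - a z * b₁ z = K) (hK0 : K ≠ 0)
    (hp : AnalyticAt ℂ p z) (hα : AnalyticAt ℂ α z) (hz : b z ≠ 0) (hpz : p z ≠ 0) :
    schwarzianExpr (fun w => a w / b w) z = schwarzianOfDeriv p z
      + 2 * α z * (deriv p z / p z) - 2 * deriv α z - 2 * α z ^ 2 - 2 * (β z * p z) := by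
  have hl : AnalyticAt ℂ (fun w => deriv p w / p w) z := hp.deriv.div hp hpz
  have hS : schwarzianOfDeriv p z = deriv (fun w => deriv p w / p w) z
      - (deriv p z / p z) ^ 2 / 2 := by
    refine schwarzianOfDeriv_eq_of_logDeriv (l := fun w => deriv p w / p w) ?_
      hl.differentiableAt.hasDerivAt hpz
    filter_upwards [hp.eventually_analyticAt, hp.continuousAt.eventually_ne hpz] with w hw hw0
    refine hw.differentiableAt.hasDerivAt.congr_deriv ?_
    rw [mul_div_cancel₀ _ hw0]
  rw [schwarzianExpr_eq, schwarzianOfDeriv_congr (ha.deriv_div_eventuallyEq hb hK hz), hS]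
  have hd : HasDerivAt (fun w => deriv p w / p w - 2 * (α w + p w * b₁ w / b w)) _ z :=
    hl.differentiableAt.hasDerivAt.fun_sub ((hα.differentiableAt.hasDerivAt.fun_add
      ((hp.differentiableAt.hasDerivAt.fun_mul (hb z).2).fun_div (hb z).1 hz)).const_mul 2)
  rw [schwarzianOfDeriv_eq_of_logDeriv (p := fun w => p w * (K / b w ^ 2))
    (l := fun w => deriv p w / p w - 2 * (α w + p w * b₁ w / b w)) ?_ hd
    (mul_ne_zero hpz (div_ne_zero hK0 (pow_ne_zero 2 hz)))]
  · generalize deriv (fun w => deriv p w / p w) z = d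
    field_simp
    ring
  · filter_upwards [hp.eventually_analyticAt, hp.continuousAt.eventually_ne hpz,
      (hb.analyticAt z).continuousAt.eventually_ne hz] with w hw hw0 hbw
    refine (hw.differentiableAt.hasDerivAt.fun_mul ((hasDerivAt_const w K).fun_div
      ((hb w).1.fun_pow 2) (pow_ne_zero 2 hbw))).congr_deriv ?_
    simp only [Nat.cast_ofNat, Nat.add_one_sub_one, pow_one]
    field_simp
    ring

end quotient

theorem exists_solvesSystem {p α β : ℂ → ℂ} (hp : Differentiable ℂ p) (hα : Differentiable ℂ α)
    (hβ : Differentiable ℂ β) (x y : ℂ) :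
    ∃ a a₁, SolvesSystem p α β a a₁ ∧ a 0 = x ∧ a₁ 0 = y := by
  have hA : Differentiable ℂ fun z =>
      α z • ((ContinuousLinearMap.fst ℂ ℂ ℂ).prod (-ContinuousLinearMap.snd ℂ ℂ ℂ)) +
      p z • ((ContinuousLinearMap.snd ℂ ℂ ℂ).prod (0 : ℂ × ℂ →L[ℂ] ℂ)) +
      β z • ((0 : ℂ × ℂ →L[ℂ] ℂ).prod (ContinuousLinearMap.fst ℂ ℂ ℂ)) :=
    ((hα.smul_const _).add (hp.smul_const _)).add (hβ.smul_const _)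
  obtain ⟨Y, hY0, hY⟩ := exists_entire_solution hA (x, y)
  refine ⟨fun z => (Y z).1, fun z => (Y z).2, fun z => ⟨?_, ?_⟩, by simp [hY0], by simp [hY0]⟩
  · refine (hasFDerivAt_fst.comp_hasDerivAt z (hY z)).congr_deriv ?_
    simp
  · refine (hasFDerivAt_snd.comp_hasDerivAt z (hY z)).congr_deriv ?_
    simp
    ring

/-! ### Choice of coefficients and part (a) -/

theorem analyticOrderAt_prod_sub_of_notMem {c : Fin k → ℂ} {z : ℂ} (hz : z ∉ Set.range c) :
    analyticOrderAt (fun z => ∏ j, (z - c j)) z = 0 :=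
  ((differentiable_prod_sub c _).analyticAt z).analyticOrderAt_eq_zero.mpr (prod_sub_ne_zero hz)

theorem analyticOrderAt_prod_sub_self {c : Fin k → ℂ} (hc : Function.Injective c) (i : Fin k) :
    analyticOrderAt (fun z => ∏ j, (z - c j)) (c i) = 1 := by
  refine (((differentiable_prod_sub c _).analyticAt _).analyticOrderAt_eq_natCast (n := 1)).mpr
    ⟨_, (differentiable_prod_sub c _).analyticAt _, prod_erase_ne_zero hc i,
      Eventually.of_forall fun z => ?_⟩
  rw [prod_sub_eq c i, pow_one, smul_eq_mul]

/-- Lagrange interpolation by an entire function. -/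
theorem exists_differentiable_interpolation {c : Fin k → ℂ} (hc : Function.Injective c)
    (y : Fin k → ℂ) : ∃ α : ℂ → ℂ, Differentiable ℂ α ∧ ∀ i, α (c i) = y i := by
  refine ⟨fun z => ∑ i, y i * e c i z,
    Differentiable.fun_sum fun i _ => (differentiable_e c i).const_mul (y i), fun i => ?_⟩
  change ∑ j, y j * e c j (c i) = y i
  rw [Finset.sum_eq_single i (fun j _ hj => by rw [e_of_ne c hj.symm, mul_zero])
    (fun h => absurd (Finset.mem_univ i) h), e_self c hc, mul_one]

theorem exists_schwarzian_coefficients {c : Fin k → ℂ} (hc : Function.Injective c)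
    (r : Fin k → ℂ) {G : ℂ → ℂ} (hG : Differentiable ℂ G) :
    ∃ α β : ℂ → ℂ, Differentiable ℂ α ∧ Differentiable ℂ β ∧ ∀ z ∉ Set.range c,
      schwarzianOfDeriv (fun z => ∏ j, (z - c j)) z
        + 2 * α z * (deriv (fun z => ∏ j, (z - c j)) z / ∏ j, (z - c j))
        - 2 * deriv α z - 2 * α z ^ 2 - 2 * (β z * ∏ j, (z - c j)) = psi c r G z := by
  set p : ℂ → ℂ := fun z => ∏ j, (z - c j) with hp
  set u : Fin k → ℂ → ℂ := fun i z => ∏ j ∈ Finset.univ.erase i, (z - c j) with hu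
  have hua : ∀ i z, AnalyticAt ℂ (u i) z := fun i z => (differentiable_prod_sub c _).analyticAt z
  have hpa : ∀ z, AnalyticAt ℂ p z := fun z => (differentiable_prod_sub c _).analyticAt z
  -- These values solve `2 α(c i) - u'(c i)/u(c i) = r i`, the residue at an apparent singularity.
  obtain ⟨α, hα, hαc⟩ := exists_differentiable_interpolation hc fun i =>
    (r i + deriv (u i) (c i) / u i (c i)) / 2
  have hF : ∀ i, HasApparentSingularity (fun z => schwarzianOfDeriv p z
      + 2 * α z * (deriv p z / p z) - 2 * deriv α z - 2 * α z ^ 2) (c i) (r i) := fun i => by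
    have := hasApparentSingularity_schwarzianOfDeriv (p := p) (hua i (c i))
      (prod_erase_ne_zero hc i) (hα.analyticAt (c i))
      (Eventually.of_forall fun z => prod_sub_eq c i z)
    rwa [hαc i, mul_div_cancel₀ _ (two_ne_zero' ℂ), add_sub_cancel_right] at this
  obtain ⟨B, hB, hBF⟩ := exists_entire_sub_eq_mul_prod hc hF
    (fun i => hasApparentSingularity_psi hc hG i) fun z hz => by
      have hαz := hα.analyticAt z
      have h1 := schwarzianOfDeriv_analyticAt (hpa z) (prod_sub_ne_zero hz)
      have h2 : AnalyticAt ℂ (fun z => deriv p z / p z) z :=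
        (hpa z).deriv.div (hpa z) (prod_sub_ne_zero hz)
      have h3 := analyticAt_psi (r := r) hG hz
      have h4 := hαz.deriv
      fun_prop
  refine ⟨α, fun z => B z / 2, hα, hB.div_const 2, fun z hz => ?_⟩
  linear_combination hBF z hz

theorem exists_hasSimpleCriticalPointsAt {c : Fin k → ℂ} (hc : Function.Injective c)
    (r : Fin k → ℂ) {G : ℂ → ℂ} (hG : Differentiable ℂ G) :
    ∃ f : ℂ → ℂ, HasSimpleCriticalPointsAt f c ∧ SchwarzianEqPsi f c r G := by
  obtain ⟨α, β, hα, hβ, hψ⟩ := exists_schwarzian_coefficients hc r hG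
  have hp := differentiable_prod_sub c Finset.univ
  set p : ℂ → ℂ := fun z => ∏ j, (z - c j) with hpdef
  -- The initial values make the Wronskian `1`, so `a` and `b` have no common zero.
  obtain ⟨a, a₁, ha, ha0, ha10⟩ := exists_solvesSystem hp hα hβ 0 1
  obtain ⟨b, b₁, hb, hb0, hb10⟩ := exists_solvesSystem hp hα hβ 1 0
  have hK : ∀ z, a₁ z * b z - a z * b₁ z = 1 := fun z => by
    rw [ha.wronskian_eq hb z, ha0, ha10, hb0, hb10]; ring
  have hK' : ∀ z, b₁ z * a z - b z * a₁ z = -1 := fun z => by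
    rw [hb.wronskian_eq ha z, ha0, ha10, hb0, hb10]; ring
  have haz : ∀ {z}, b z = 0 → a z ≠ 0 := fun {z} hbz haz => by
    have := hK z
    simp [hbz, haz] at this
  have hord : ∀ z, analyticOrderAt p z ≠ ⊤ := fun z => by
    by_cases hz : z ∈ Set.range c
    · obtain ⟨i, rfl⟩ := hz
      simp [hpdef, analyticOrderAt_prod_sub_self hc i]
    · simp [hpdef, analyticOrderAt_prod_sub_of_notMem hz]
  set f : ℂ → ℂ := fun z => a z / b z with hf
  have hfa : ∀ {z}, b z ≠ 0 → AnalyticAt ℂ f z := fun {z} hz =>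
    (ha.analyticAt z).div (hb.analyticAt z) hz
  have hga : ∀ {z}, b z = 0 → AnalyticAt ℂ (fun w => b w / a w) z := fun {z} hz =>
    (hb.analyticAt z).div (ha.analyticAt z) (haz hz)
  -- Exchanging `a` and `b` turns the constant into `-1`, and `1/f = b/a` vanishes at `z` to order
  -- one more than `p`. A zero of `b` at some `c i` thus gives a double pole, still a simple
  -- critical point.
  have hpole : ∀ {z}, b z = 0 → IsPole f z := fun {z} hz => by
    have h1 := meromorphicOrderAt_sub_eq (hga hz)
    rw [hb.analyticOrderAt_deriv_div ha hK' (by norm_num) (hp.analyticAt z) (haz hz)] at h1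
    simp only [hz, zero_div, sub_zero] at h1
    have h2 : f = (fun w => b w / a w)⁻¹ := by
      funext w
      simp [hf]
    rw [IsPole, h2, meromorphicOrderAt_inv, h1]
    generalize hn : analyticOrderAt p z = n
    induction n using ENat.recTopCoe with
    | top => exact absurd hn (hord z)
    | coe n =>
      rw [← Nat.cast_one, ← Nat.cast_add, ENat.map_natCast]
      norm_cast
      omega
  have hNF : IsMeromorphicOnPlane f := fun z _ =>
    MeromorphicNFOn.div (ha.analyticAt z) (hb.analyticAt z).meromorphicNFAt
      ((em' (b z = 0)).imp_right haz)
  have hdeg : ∀ z, localDegree f z = (analyticOrderAt p z + 1).map (Nat.cast : ℕ → ℤ) := fun z => by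
    by_cases hz : b z = 0
    · rw [localDegree_of_isPole (hpole hz) (hga hz) (by simp [hz]) (fun w => by simp [hf]),
        hb.analyticOrderAt_deriv_div ha hK' (by norm_num) (hp.analyticAt z) (haz hz)]
    · rw [localDegree_of_analyticAt (hfa hz),
        ha.analyticOrderAt_deriv_div hb hK one_ne_zero (hp.analyticAt z) hz]
  have hexpr : ∀ {z}, b z ≠ 0 → z ∉ Set.range c → schwarzianExpr f z = psi c r G z :=
    fun {z} hz hzc => by
      rw [← hψ z hzc]
      exact ha.schwarzianExpr_div hb hK one_ne_zero (hp.analyticAt z) (hα.analyticAt z) hz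
        (prod_sub_ne_zero hzc)
  refine ⟨f, ⟨hNF, ?_, fun i => ?_⟩, fun z hz => ?_⟩
  · ext z
    rw [Set.mem_ofPred_eq, IsCriticalPoint, hdeg, Ne, map_natCast_add_one_eq_one]
    constructor
    · exact fun h => not_not.mp fun hz => h (analyticOrderAt_prod_sub_of_notMem hz)
    · rintro ⟨i, rfl⟩
      simp [hpdef, analyticOrderAt_prod_sub_self hc i]
  · rw [IsSimpleCriticalPoint, hdeg, map_natCast_add_one_eq_two]
    exact analyticOrderAt_prod_sub_self hc i
  · by_cases hbz : b z = 0
    · rw [schwarzian, if_pos (hpole hbz)]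
      have hm : MeromorphicAt f z := (hNF (Set.mem_univ z)).meromorphicAt
      have hne := (meromorphicOrderAt_ne_top_iff_eventually_ne_zero hm).mp
        (ne_top_of_lt (hpole hbz))
      have hzc : ∀ᶠ w in 𝓝 z, w ∉ Set.range c :=
        (Set.finite_range c).isClosed.isOpen_compl.mem_nhds hz
      refine Tendsto.limUnder_eq (((analyticAt_psi (r := r) hG hz).continuousAt.tendsto.mono_left
        nhdsWithin_le_nhds).congr' ?_)
      filter_upwards [hne, eventually_nhdsWithin_of_eventually_nhds hzc] with w hw hwc
      exact (hexpr (fun h => hw (by simp [hf, h])) hwc).symm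
    · rw [schwarzian, if_neg (not_isPole_of_analyticAt (hfa hbz))]
      exact hexpr hbz hz

end SchwarzianMerom

end

theorem theorem1p3 (k : ℕ) (hk : 1 ≤ k) (c : Fin k → ℂ) (hc : Function.Injective c) :
    (∀ (r : Fin k → ℂ) (G : ℂ → ℂ), Differentiable ℂ G →
      ∃ f : ℂ → ℂ, SchwarzianMerom.HasSimpleCriticalPointsAt f c ∧
        SchwarzianMerom.SchwarzianEqPsi f c r G) ∧
    (∀ f : ℂ → ℂ, SchwarzianMerom.HasSimpleCriticalPointsAt f c →
      ∃ (r : Fin k → ℂ) (G : ℂ → ℂ), Differentiable ℂ G ∧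
        SchwarzianMerom.SchwarzianEqPsi f c r G) :=
  ⟨fun r _ hG => SchwarzianMerom.exists_hasSimpleCriticalPointsAt hc r hG,
    fun _ hf => SchwarzianMerom.exists_schwarzianEqPsi hc hf⟩
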